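/- For complex $\nu$ and $\operatorname{Re} z>0$ let $K_\nu(z)=\int_0^\infty e^{-z\cosh y}\cosh(\nu y)\,dy$ be the modified Bessel function of the second kind, and let the Kelvin functions $\mathrm{ker}_\nu,\mathrm{kei}_\nu$ be defined for $x>0$ by the two equalities $$\mathrm{ker}_\nu(x)\pm i\,\mathrm{kei}_\nu(x)=e^{\mp\nu\pi i/2}\,K_\nu\!\left(x e^{\pm\pi i/4}\right).$$ For $x>0$ and $\tau\in\mathbb R$ put $$\mathcal K(x,\tau)=\mathrm{ker}_{2i\tau}^2\!\left(2(4x)^{1/4}\right)+\mathrm{kei}_{2i\tau}^2\!\left(2(4x)^{1/4}\right).$$ Then for each $\tau\in\mathbb R$ the function $x\mapsto\mathcal K(x,\tau)$ is four times continuously differentiable on $(0,\infty)$ and satisfies the fourth-order differential equation $$x^3\frac{d^4\mathcal K}{dx^4}+\frac{11}{2}x^2\frac{d^3\mathcal K}{dx^3}+x\left(\frac{11}{2}+\tau^2\right)\frac{d^2\mathcal K}{dx^2}+\frac12\left(1+\tau^2\right)\frac{d\mathcal K}{dx}-\mathcal K=0,\qquad x>0.$$ Equivalently, $$\left(\frac{d}{dx}\,x^{1/2}\,\frac{d}{dx}\right)\left(\left(x\frac{d}{dx}\right)^2+\tau^2\right)\mathcal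 K(x,\tau)=\frac{1}{\sqrt x}\,\mathcal K(x,\tau),\qquad x>0.$$ -/

import Mathlib

open MeasureTheory Set

noncomputable section

namespace KelvinIndex

/-- The modified Bessel function of the second kind (Macdonald function)
`K_ν(z) = ∫_0^∞ exp (-z cosh y) cosh (ν y) dy`, for `Re z > 0` and any complex index `ν`. -/
def besselK (ν z : ℂ) : ℂ :=
  ∫ y in Ioi (0 : ℝ), Complex.exp (-z * Complex.cosh (y : ℂ)) * Complex.cosh (ν * (y : ℂ))

/-- `ker_ν(x) + i kei_ν(x) = exp (-ν π i / 2) K_ν (x exp (π i / 4))`. -/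
def kelvinPlus (ν : ℂ) (x : ℝ) : ℂ :=
  Complex.exp (-(ν * Real.pi * Complex.I / 2)) *
    besselK ν ((x : ℂ) * Complex.exp (Real.pi * Complex.I / 4))

/-- `ker_ν(x) - i kei_ν(x) = exp (ν π i / 2) K_ν (x exp (-π i / 4))`. -/
def kelvinMinus (ν : ℂ) (x : ℝ) : ℂ :=
  Complex.exp (ν * Real.pi * Complex.I / 2) *
    besselK ν ((x : ℂ) * Complex.exp (-(Real.pi * Complex.I / 4)))

/-- The Kelvin function `ker_ν(x)`, `x > 0`, of complex index `ν` (complex-valued in general). -/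
def ker (ν : ℂ) (x : ℝ) : ℂ :=
  (kelvinPlus ν x + kelvinMinus ν x) / 2

/-- The Kelvin function `kei_ν(x)`, `x > 0`, of complex index `ν` (complex-valued in general). -/
def kei (ν : ℂ) (x : ℝ) : ℂ :=
  (kelvinPlus ν x - kelvinMinus ν x) / (2 * Complex.I)

/-- The kernel `𝒦(x, τ) = ker_{2iτ}(2 (4x)^{1/4})^2 + kei_{2iτ}(2 (4x)^{1/4})^2`, `x > 0`. -/
def kernel (x τ : ℝ) : ℂ :=
  ker (2 * Complex.I * τ) (2 * (4 * x) ^ (1 / 4 : ℝ)) ^ 2 +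
    kei (2 * Complex.I * τ) (2 * (4 * x) ^ (1 / 4 : ℝ)) ^ 2

/-- The operator `x d/dx` on complex-valued functions of a real variable. -/
def eulerOp (f : ℝ → ℂ) : ℝ → ℂ := fun x => (x : ℂ) * deriv f x

/-- The operator `(d/dx) x^{1/2} (d/dx)` on complex-valued functions of a real variable. -/
def sqrtOp (f : ℝ → ℂ) : ℝ → ℂ := deriv (fun x => (Real.sqrt x : ℂ) * deriv f x)

end KelvinIndex

end

/-! The exponential prefactors cancel in `ker² + kei²`, so the kernel is a product `a b` with `a, b
= K_ν(z)`, `z = 2(4x)^{1/4} e^{±πi/4}`, `ν = 2iτ` (`kernel_eq`). Write `θ = x d/dx`, which is a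
quarter of `z d/dz`. Since `z² = ±8i√x` and `ν² = -4τ²`, the modified Bessel equation
(`besselMoment_equation`) becomes `θ²a = (i√x/2 - τ²/4)a` and `θ²b = (-i√x/2 - τ²/4)b`. Hence `(θ² +
τ²)(ab) = 2 θa θb + (τ²/2) ab`. Applying `√x d/dx` cancels the `τ²` terms and leaves `i(a θb - b
θa)`, whose derivative is `ab/√x` (`sqrtOp_eulerOp_mul_eq`). The expanded equation is this one
multiplied by `√x` (`sqrt_mul_sqrtOp_eulerOp`). Smoothness holds because `K_ν` is holomorphic on the
right half-plane. -/

namespace KelvinIndex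

open Filter Topology

/-! ### Decay estimates -/

/-- Doubly exponential decay dominates simple exponential growth, with an explicit constant. -/
theorem neg_mul_cosh_add_mul_le {r y : ℝ} (hr : 0 < r) (m : ℝ) (hy : 0 ≤ y) :
    -r * Real.cosh y + m * y ≤ (m + 1) ^ 2 / r - y := by
  have hcosh : y ^ 2 / 4 ≤ Real.cosh y := by
    have h := Real.quadratic_le_exp_of_nonneg hy
    have h' := Real.exp_pos (-y)
    rw [Real.cosh_eq]
    nlinarith
  -- Completing the square; `m + 1` in place of `m` leaves a spare `-y`, hence the integrable
  -- majorant `e^{-y}`.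
  have hsq : (m + 1) ^ 2 / r - (m + 1) * y + r * (y ^ 2 / 4) = (m + 1 - r * y / 2) ^ 2 / r := by
    field_simp
    ring
  have hnonneg : 0 ≤ (m + 1 - r * y / 2) ^ 2 / r := by positivity
  nlinarith [mul_le_mul_of_nonneg_left hcosh hr.le]

theorem exp_neg_mul_cosh_add_mul_le {r y : ℝ} (hr : 0 < r) (m : ℝ) (hy : 0 ≤ y) :
    Real.exp (-r * Real.cosh y + m * y) ≤ Real.exp ((m + 1) ^ 2 / r) * Real.exp (-y) := by
  rw [← Real.exp_add]
  exact Real.exp_le_exp.2 (by linarith [neg_mul_cosh_add_mul_le hr m hy])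

theorem integrableOn_exp_neg_mul_cosh_add_mul {r : ℝ} (hr : 0 < r) (m : ℝ) :
    IntegrableOn (fun y : ℝ => Real.exp (-r * Real.cosh y + m * y)) (Ioi 0) := by
  refine Integrable.mono' ((integrableOn_exp_neg_Ioi 0).const_mul (Real.exp ((m + 1) ^ 2 / r)))
    (by fun_prop) ?_
  filter_upwards [ae_restrict_mem measurableSet_Ioi] with y hy
  rw [Real.norm_eq_abs, abs_of_pos (Real.exp_pos _)]
  exact exp_neg_mul_cosh_add_mul_le hr m (le_of_lt hy)

theorem tendsto_exp_neg_mul_cosh_add_mul {r : ℝ} (hr : 0 < r) (m : ℝ) :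
    Tendsto (fun y : ℝ => Real.exp (-r * Real.cosh y + m * y)) atTop (𝓝 0) := by
  have h : Tendsto (fun y : ℝ => Real.exp ((m + 1) ^ 2 / r) * Real.exp (-y)) atTop (𝓝 0) := by
    simpa using (Real.tendsto_exp_neg_atTop_nhds_zero).const_mul (Real.exp ((m + 1) ^ 2 / r))
  refine squeeze_zero' (Eventually.of_forall fun y => (Real.exp_pos _).le) ?_ h
  filter_upwards [eventually_ge_atTop 0] with y hy
  exact exp_neg_mul_cosh_add_mul_le hr m hy

theorem norm_exp_le_exp_norm_mul (ν : ℂ) {y : ℝ} (hy : 0 ≤ y) :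
    ‖Complex.exp (ν * y)‖ ≤ Real.exp (‖ν‖ * y) ∧
      ‖Complex.exp (-(ν * y))‖ ≤ Real.exp (‖ν‖ * y) := by
  have h : ‖ν * (y : ℂ)‖ = ‖ν‖ * y := by
    rw [norm_mul, Complex.norm_real, Real.norm_of_nonneg hy]
  constructor
  · rw [Complex.norm_exp, Real.exp_le_exp, ← h]
    exact Complex.re_le_norm _
  · rw [Complex.norm_exp, Real.exp_le_exp, ← h, ← norm_neg]
    exact Complex.re_le_norm _

theorem norm_cosh_mul_le (ν : ℂ) {y : ℝ} (hy : 0 ≤ y) :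
    ‖Complex.cosh (ν * y)‖ ≤ Real.exp (‖ν‖ * y) := by
  obtain ⟨h₁, h₂⟩ := norm_exp_le_exp_norm_mul ν hy
  rw [Complex.cosh, norm_div, Complex.norm_ofNat]
  linarith [norm_add_le (Complex.exp (ν * y)) (Complex.exp (-(ν * y)))]

theorem norm_sinh_mul_le (ν : ℂ) {y : ℝ} (hy : 0 ≤ y) :
    ‖Complex.sinh (ν * y)‖ ≤ Real.exp (‖ν‖ * y) := by
  obtain ⟨h₁, h₂⟩ := norm_exp_le_exp_norm_mul ν hy
  rw [Complex.sinh, norm_div, Complex.norm_ofNat]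
  linarith [norm_sub_le (Complex.exp (ν * y)) (Complex.exp (-(ν * y)))]

theorem norm_exp_neg_mul_cosh (z : ℂ) (y : ℝ) :
    ‖Complex.exp (-z * Complex.cosh y)‖ = Real.exp (-z.re * Real.cosh y) := by
  rw [Complex.norm_exp, ← Complex.ofReal_cosh, Complex.re_mul_ofReal, Complex.neg_re]

/-! ### Moments of the Macdonald integral and the modified Bessel equation -/

/-- The integrand of the `n`-th `cosh`-moment of the integral defining `K_ν(z)`. -/
noncomputable def besselIntegrand (ν : ℂ) (n : ℕ) (z : ℂ) (y : ℝ) : ℂ :=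
  Complex.cosh y ^ n * (Complex.exp (-z * Complex.cosh y) * Complex.cosh (ν * y))

theorem continuous_besselIntegrand (ν : ℂ) (n : ℕ) (z : ℂ) :
    Continuous (besselIntegrand ν n z) := by
  unfold besselIntegrand
  fun_prop

theorem norm_besselIntegrand_le (ν : ℂ) (n : ℕ) {z : ℂ} {r y : ℝ} (hz : r ≤ z.re)
    (hy : 0 ≤ y) :
    ‖besselIntegrand ν n z y‖ ≤ Real.exp (-r * Real.cosh y + (n + ‖ν‖) * y) := by
  have h₁ : ‖Complex.cosh (y : ℂ)‖ ≤ Real.exp y := by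
    simpa using norm_cosh_mul_le 1 hy
  have h₂ : ‖Complex.cosh (y : ℂ)‖ ^ n ≤ Real.exp (n * y) := by
    rw [Real.exp_nat_mul]
    gcongr
  have h₃ : Real.exp (-z.re * Real.cosh y) ≤ Real.exp (-r * Real.cosh y) := by
    have := Real.cosh_pos y
    gcongr
  rw [besselIntegrand, norm_mul, norm_mul, norm_pow, norm_exp_neg_mul_cosh]
  calc _ ≤ Real.exp (n * y) * (Real.exp (-r * Real.cosh y) * Real.exp (‖ν‖ * y)) := by
        gcongr
        exact norm_cosh_mul_le ν hy
    _ = _ := by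
        rw [← Real.exp_add, ← Real.exp_add]
        congr 1
        ring

theorem integrableOn_besselIntegrand (ν : ℂ) (n : ℕ) {z : ℂ} (hz : 0 < z.re) :
    IntegrableOn (besselIntegrand ν n z) (Ioi 0) := by
  refine Integrable.mono' (integrableOn_exp_neg_mul_cosh_add_mul hz (n + ‖ν‖))
    (continuous_besselIntegrand ν n z).aestronglyMeasurable ?_
  filter_upwards [ae_restrict_mem measurableSet_Ioi] with y hy
  exact norm_besselIntegrand_le ν n le_rfl (le_of_lt hy)

/-- The `n`-th `cosh`-moment of the integral defining `K_ν(z)`. -/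
noncomputable def besselMoment (ν : ℂ) (n : ℕ) (z : ℂ) : ℂ :=
  ∫ y in Ioi (0 : ℝ), besselIntegrand ν n z y

theorem besselMoment_zero (ν z : ℂ) : besselMoment ν 0 z = besselK ν z := by
  simp [besselMoment, besselIntegrand, besselK]

theorem hasDerivAt_besselMoment (ν : ℂ) (n : ℕ) {z : ℂ} (hz : 0 < z.re) :
    HasDerivAt (besselMoment ν n) (-besselMoment ν (n + 1) z) z := by
  -- On this half-plane a single majorant, with `r = Re z / 2`, serves all parameters.
  have hs : {w : ℂ | z.re / 2 < w.re} ∈ 𝓝 z :=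
    (isOpen_lt continuous_const Complex.continuous_re).mem_nhds (half_lt_self hz)
  have h := (hasDerivAt_integral_of_dominated_loc_of_deriv_le
    (μ := volume.restrict (Ioi (0 : ℝ))) (F := besselIntegrand ν n)
    (F' := fun w y => -besselIntegrand ν (n + 1) w y) (x₀ := z) hs
    (bound := fun y => Real.exp (-(z.re / 2) * Real.cosh y + ((n + 1 : ℕ) + ‖ν‖) * y))
    (Eventually.of_forall fun w => (continuous_besselIntegrand ν n w).aestronglyMeasurable)
    (integrableOn_besselIntegrand ν n hz)
    (continuous_besselIntegrand ν (n + 1) z).neg.aestronglyMeasurable ?_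
    (integrableOn_exp_neg_mul_cosh_add_mul (half_pos hz) _) ?_).2
  · rw [integral_neg] at h
    exact h
  · filter_upwards [ae_restrict_mem measurableSet_Ioi] with y hy w hw
    rw [norm_neg]
    exact norm_besselIntegrand_le ν (n + 1) (le_of_lt hw) (le_of_lt hy)
  · refine Eventually.of_forall fun y w _ => ?_
    have h := (((((hasDerivAt_id' w).neg).mul_const (Complex.cosh y)).cexp.mul_const
      (Complex.cosh (ν * y))).const_mul (Complex.cosh y ^ n))
    refine h.congr_deriv ?_
    simp only [besselIntegrand, Pi.neg_apply]
    ring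

/-- The modified Bessel equation, in terms of `cosh`-moments. -/
theorem besselMoment_equation (ν : ℂ) {z : ℂ} (hz : 0 < z.re) :
    z ^ 2 * besselMoment ν 2 z - z * besselMoment ν 1 z = (z ^ 2 + ν ^ 2) * besselMoment ν 0 z := by
  have hint := fun n => integrableOn_besselIntegrand ν n hz
  -- The primitive is the Wronskian `E'C - EC'` of `E = exp(-z cosh y)` and `C = cosh(νy)`, so its
  -- derivative is `E''C - EC''`; it vanishes at `0` and at infinity.
  have hderiv : ∀ y ∈ Ici (0 : ℝ), HasDerivAt
      (fun y : ℝ => -Complex.exp (-z * Complex.cosh y) *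
        (z * Complex.sinh y * Complex.cosh (ν * y) + ν * Complex.sinh (ν * y)))
      (z ^ 2 * besselIntegrand ν 2 z y - z * besselIntegrand ν 1 z y -
        (z ^ 2 + ν ^ 2) * besselIntegrand ν 0 z y) y := by
    intro y _
    have hid : HasDerivAt (fun w : ℂ => w) 1 y := hasDerivAt_id' _
    have hν := hid.const_mul ν
    have h := ((hid.ccosh.const_mul (-z)).cexp).neg.mul
      (((hid.csinh.const_mul z).mul hν.ccosh).add (hν.csinh.const_mul ν))
    refine h.comp_ofReal.congr_deriv ?_
    simp only [besselIntegrand, Pi.neg_apply, Pi.add_apply, Pi.mul_apply]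
    linear_combination (-z ^ 2 * Complex.exp (-z * Complex.cosh y) * Complex.cosh (ν * y)) *
      Complex.cosh_sq_sub_sinh_sq (y : ℂ)
  have hlim : Tendsto (fun y : ℝ => -Complex.exp (-z * Complex.cosh y) *
      (z * Complex.sinh y * Complex.cosh (ν * y) + ν * Complex.sinh (ν * y))) atTop (𝓝 0) := by
    have h := (tendsto_exp_neg_mul_cosh_add_mul hz (1 + ‖ν‖)).const_mul (‖z‖ + ‖ν‖)
    rw [mul_zero] at h
    refine squeeze_zero_norm' ?_ h
    filter_upwards [eventually_ge_atTop 0] with y hy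
    have h₁ : ‖Complex.sinh (y : ℂ)‖ ≤ Real.exp y := by
      simpa using norm_sinh_mul_le 1 hy
    have h₂ := norm_cosh_mul_le ν hy
    have h₃ := norm_sinh_mul_le ν hy
    have h₄ : 1 ≤ Real.exp y := Real.one_le_exp hy
    rw [norm_mul, norm_neg, norm_exp_neg_mul_cosh]
    calc _ ≤ Real.exp (-z.re * Real.cosh y) *
          (‖z‖ * Real.exp y * Real.exp (‖ν‖ * y) + ‖ν‖ * (Real.exp y * Real.exp (‖ν‖ * y))) := by
          gcongr
          refine (norm_add_le _ _).trans ?_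
          rw [norm_mul, norm_mul, norm_mul]
          gcongr
          exact h₃.trans (le_mul_of_one_le_left (Real.exp_pos _).le h₄)
      _ = _ := by
          rw [add_mul 1, one_mul, Real.exp_add, Real.exp_add]
          ring
  have h₂ : IntegrableOn (fun y => z ^ 2 * besselIntegrand ν 2 z y) (Ioi 0) := (hint 2).const_mul _
  have h₁ : IntegrableOn (fun y => z * besselIntegrand ν 1 z y) (Ioi 0) := (hint 1).const_mul _
  have h₀ : IntegrableOn (fun y => (z ^ 2 + ν ^ 2) * besselIntegrand ν 0 z y) (Ioi 0) :=
    (hint 0).const_mul _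
  have h₂₁ : IntegrableOn (fun y => z ^ 2 * besselIntegrand ν 2 z y - z * besselIntegrand ν 1 z y)
    (Ioi 0) := h₂.sub h₁
  have h := integral_Ioi_of_hasDerivAt_of_tendsto' hderiv (h₂₁.sub h₀) hlim
  rw [integral_sub h₂₁ h₀, integral_sub h₂ h₁, integral_const_mul, integral_const_mul,
    integral_const_mul] at h
  simp only [Complex.ofReal_zero, Complex.sinh_zero, mul_zero, zero_mul, add_zero, sub_zero] at h
  exact sub_eq_zero.1 h

theorem differentiableOn_besselK (ν : ℂ) : DifferentiableOn ℂ (besselK ν) {z | 0 < z.re} := by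
  have h : besselMoment ν 0 = besselK ν := funext (besselMoment_zero ν)
  exact fun z hz => h ▸ (hasDerivAt_besselMoment ν 0 hz).differentiableAt.differentiableWithinAt

theorem contDiffAt_besselK (ν : ℂ) {z : ℂ} (hz : 0 < z.re) (n : WithTop ℕ∞) :
    ContDiffAt ℂ n (besselK ν) z :=
  ((differentiableOn_besselK ν).analyticAt
    ((isOpen_lt continuous_const Complex.continuous_re).mem_nhds hz)).contDiffAt

/-- If `u` solves `x u' = u / 4`, then `x ↦ K_ν(u x)` has the Euler derivative `-u M₁(u) / 4`. -/
theorem hasDerivAt_besselK_comp (ν : ℂ) {u : ℝ → ℂ} {x : ℝ} (hre : 0 < (u x).re)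
    (hu : HasDerivAt u (u x / (4 * x)) x) :
    HasDerivAt (fun t => besselK ν (u t)) (-(u x) / 4 * besselMoment ν 1 (u x) / x) x := by
  have h := (hasDerivAt_besselMoment ν 0 hre).comp x hu
  rw [show besselMoment ν 0 = besselK ν from funext (besselMoment_zero ν)] at h
  refine h.congr_deriv ?_
  ring

/-- Second half of the Bessel equation as a first-order system in `θ`; the `1/16` comes from
applying `θ = (z d/dz)/4` twice. -/
theorem hasDerivAt_besselMoment_one_comp (ν : ℂ) {u : ℝ → ℂ} {x : ℝ} (hre : 0 < (u x).re)
    (hu : HasDerivAt u (u x / (4 * x)) x) :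
    HasDerivAt (fun t => -(u t) / 4 * besselMoment ν 1 (u t))
      (((u x) ^ 2 + ν ^ 2) / 16 * besselK ν (u x) / x) x := by
  have h := (hu.neg.div_const 4).mul ((hasDerivAt_besselMoment ν 1 hre).comp x hu)
  refine h.congr_deriv ?_
  rw [← besselMoment_zero]
  simp only [Function.comp_apply, Pi.neg_apply, Nat.reduceAdd]
  linear_combination (1 / (16 * x) : ℂ) * besselMoment_equation ν hre

/-! ### The fourth-root substitution and the product formula -/

/-- The argument `2 (4x)^{1/4}` of the Kelvin functions. -/
noncomputable def kelvinArg (x : ℝ) : ℝ := 2 * (4 * x) ^ (1 / 4 : ℝ)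

theorem kelvinArg_pos {x : ℝ} (hx : 0 < x) : 0 < kelvinArg x := by
  unfold kelvinArg
  positivity

theorem kelvinArg_sq {x : ℝ} (hx : 0 < x) : kelvinArg x ^ 2 = 8 * √x := by
  have h4 : √(4 * x) = 2 * √x := by
    rw [Real.sqrt_mul (by norm_num), show (4 : ℝ) = 2 ^ 2 by norm_num, Real.sqrt_sq (by norm_num)]
  rw [kelvinArg, mul_pow, ← Real.rpow_mul_natCast (by positivity),
    show (1 / 4 : ℝ) * (2 : ℕ) = 1 / 2 by norm_num, ← Real.sqrt_eq_rpow, h4]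
  ring

theorem contDiffAt_kelvinArg {x : ℝ} (hx : 0 < x) (n : WithTop ℕ∞) :
    ContDiffAt ℝ n kelvinArg x :=
  contDiffAt_const.mul
    ((contDiffAt_const.mul contDiffAt_id).rpow_const_of_ne (by simp [hx.ne']))

theorem hasDerivAt_kelvinArg {x : ℝ} (hx : 0 < x) :
    HasDerivAt kelvinArg (kelvinArg x / (4 * x)) x := by
  have h := (((hasDerivAt_id' x).const_mul 4).rpow_const (p := 1 / 4)
    (Or.inl (by positivity))).const_mul 2
  refine h.congr_deriv ?_
  rw [Real.rpow_sub_one (by positivity), kelvinArg]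
  field_simp

theorem hasDerivAt_kelvinArg_mul (w : ℂ) {x : ℝ} (hx : 0 < x) :
    HasDerivAt (fun t => (kelvinArg t : ℂ) * w) ((kelvinArg x : ℂ) * w / (4 * x)) x := by
  refine ((hasDerivAt_kelvinArg hx).ofReal_comp.mul_const w).congr_deriv ?_
  push_cast
  ring

theorem re_kelvinArg_mul_pos {w : ℂ} (hw : 0 < w.re) {x : ℝ} (hx : 0 < x) :
    0 < ((kelvinArg x : ℂ) * w).re := by
  rw [Complex.re_ofReal_mul]
  exact mul_pos (kelvinArg_pos hx) hw

theorem contDiffAt_besselK_kelvinArg_mul (ν : ℂ) {w : ℂ} (hw : 0 < w.re) {x : ℝ} (hx : 0 < x)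
    (n : WithTop ℕ∞) : ContDiffAt ℝ n (fun t => besselK ν ((kelvinArg t : ℂ) * w)) x :=
  ContDiffAt.comp (g := besselK ν) (f := fun t => (kelvinArg t : ℂ) * w) x
    ((contDiffAt_besselK ν (re_kelvinArg_mul_pos hw hx) n).restrict_scalars ℝ)
    ((Complex.ofRealCLM.contDiff.contDiffAt.comp x (contDiffAt_kelvinArg hx n)).mul
      contDiffAt_const)

theorem re_exp_pi_div_four_mul_I_pos :
    0 < (Complex.exp (Real.pi * Complex.I / 4)).re ∧
      0 < (Complex.exp (-(Real.pi * Complex.I / 4))).re := by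
  simp [Complex.exp_re]

theorem exp_pi_div_four_mul_I_sq :
    Complex.exp (Real.pi * Complex.I / 4) ^ 2 = Complex.I ∧
      Complex.exp (-(Real.pi * Complex.I / 4)) ^ 2 = -Complex.I := by
  constructor
  · rw [← Complex.exp_nat_mul]
    refine Eq.trans (congrArg _ ?_) Complex.exp_pi_div_two_mul_I
    push_cast
    ring
  · rw [← Complex.exp_nat_mul, ← Complex.exp_neg_pi_div_two_mul_I]
    congr 1
    push_cast
    ring

/-- The kernel is a product of two Macdonald functions on conjugate rays. -/
theorem kernel_eq (x τ : ℝ) : kernel x τ =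
    besselK (2 * Complex.I * τ) ((kelvinArg x : ℂ) * Complex.exp (Real.pi * Complex.I / 4)) *
    besselK (2 * Complex.I * τ) ((kelvinArg x : ℂ) * Complex.exp (-(Real.pi * Complex.I / 4))) := by
  have h : ∀ p q : ℂ, ((p + q) / 2) ^ 2 + ((p - q) / (2 * Complex.I)) ^ 2 = p * q := by
    intro p q
    rw [div_pow, div_pow, mul_pow, Complex.I_sq]
    ring
  -- The prefactors of the two Kelvin combinations are reciprocal.
  have hexp := Complex.exp_neg (2 * Complex.I * τ * Real.pi * Complex.I / 2)
  have hne := Complex.exp_ne_zero (2 * Complex.I * τ * Real.pi * Complex.I / 2)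
  rw [kernel, ker, kei, h, kelvinPlus, kelvinMinus, hexp]
  change _ * besselK _ ((kelvinArg x : ℂ) * _) * (_ * besselK _ ((kelvinArg x : ℂ) * _)) = _
  field_simp

theorem contDiffOn_kernel (τ : ℝ) (n : WithTop ℕ∞) :
    ContDiffOn ℝ n (fun x : ℝ => kernel x τ) (Ioi 0) := by
  obtain ⟨h₁, h₂⟩ := re_exp_pi_div_four_mul_I_pos
  simp only [kernel_eq]
  exact fun x hx => ((contDiffAt_besselK_kelvinArg_mul _ h₁ hx n).mul
    (contDiffAt_besselK_kelvinArg_mul _ h₂ hx n)).contDiffWithinAt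

/-! ### The differential operators and the equations -/

theorem eulerOp_eq_of_hasDerivAt {f : ℝ → ℂ} {f' : ℂ} {x : ℝ} (hx : x ≠ 0)
    (h : HasDerivAt f (f' / x) x) : eulerOp f x = f' := by
  rw [eulerOp, h.deriv]
  have : (x : ℂ) ≠ 0 := Complex.ofReal_ne_zero.2 hx
  field_simp

theorem eulerOp_congr {f g : ℝ → ℂ} (h : EqOn f g (Ioi 0)) : EqOn (eulerOp f) (eulerOp g) (Ioi 0) :=
  fun x hx => by
    rw [eulerOp, eulerOp, (h.eventuallyEq_of_mem (Ioi_mem_nhds hx)).deriv_eq]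

theorem sqrtOp_congr {f g : ℝ → ℂ} (h : EqOn f g (Ioi 0)) : EqOn (sqrtOp f) (sqrtOp g) (Ioi 0) := by
  intro x hx
  refine EventuallyEq.deriv_eq ?_
  filter_upwards [Ioi_mem_nhds hx] with t ht
  rw [(h.eventuallyEq_of_mem (Ioi_mem_nhds ht)).deriv_eq]

/-- The factored equation for a product of two solutions of the Euler-type equations
`(x d/dx)² a = (± i √x / 2 - τ² / 4) a`. -/
theorem sqrtOp_eulerOp_mul_eq {a a₁ b b₁ : ℝ → ℂ} {c : ℂ}
    (ha : ∀ x : ℝ, 0 < x → HasDerivAt a (a₁ x / x) x)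
    (ha₁ : ∀ x : ℝ, 0 < x → HasDerivAt a₁ ((Complex.I * √x / 2 - c / 4) * a x / x) x)
    (hb : ∀ x : ℝ, 0 < x → HasDerivAt b (b₁ x / x) x)
    (hb₁ : ∀ x : ℝ, 0 < x → HasDerivAt b₁ ((-(Complex.I * √x / 2) - c / 4) * b x / x) x)
    {x : ℝ} (hx : 0 < x) :
    sqrtOp (fun t => eulerOp (eulerOp (fun u => a u * b u)) t + c * (a t * b t)) x =
      a x * b x / √x := by
  have h₁ : EqOn (eulerOp (fun u => a u * b u)) (fun t => a₁ t * b t + a t * b₁ t) (Ioi 0) :=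
    fun t ht => eulerOp_eq_of_hasDerivAt (ne_of_gt ht)
      (((ha t ht).mul (hb t ht)).congr_deriv (by ring))
  have h₂ : EqOn (fun t => eulerOp (eulerOp (fun u => a u * b u)) t + c * (a t * b t))
      (fun t => 2 * (a₁ t * b₁ t) + c / 2 * (a t * b t)) (Ioi 0) := by
    intro t ht
    dsimp only
    rw [eulerOp_congr h₁ ht, eulerOp_eq_of_hasDerivAt
      (f' := 2 * (a₁ t * b₁ t) - c / 2 * (a t * b t)) (ne_of_gt ht)]
    · ring
    · refine (((ha₁ t ht).mul (hb t ht)).add ((ha t ht).mul (hb₁ t ht))).congr_deriv ?_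
      ring
  -- The `c` terms cancel here: those from `θ²a`, `θ²b` are opposite to `(c/2) θ(ab)`.
  have h₃ : EqOn
      (fun t => (√t : ℂ) * deriv (fun t => 2 * (a₁ t * b₁ t) + c / 2 * (a t * b t)) t)
      (fun t => Complex.I * (a t * b₁ t - a₁ t * b t)) (Ioi 0) := by
    intro t ht
    have hd := (((ha₁ t ht).mul (hb₁ t ht)).const_mul 2).add
      (((ha t ht).mul (hb t ht)).const_mul (c / 2))
    have ht0 : (t : ℂ) ≠ 0 := Complex.ofReal_ne_zero.2 (ne_of_gt ht)
    have hs : (√t : ℂ) ^ 2 = t := by exact_mod_cast Real.sq_sqrt (le_of_lt ht)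
    refine (congrArg _ hd.deriv).trans ?_
    field_simp
    linear_combination (8 * Complex.I * (a t * b₁ t - a₁ t * b t)) * hs
  rw [sqrtOp_congr h₂ hx, sqrtOp, (h₃.eventuallyEq_of_mem (Ioi_mem_nhds hx)).deriv_eq]
  -- The products `θa θb` cancel, so only the difference `-i√x` of the two coefficients survives.
  have hd := (((ha x hx).mul (hb₁ x hx)).sub ((ha₁ x hx).mul (hb x hx))).const_mul Complex.I
  have hs : (√x : ℂ) ^ 2 = x := by exact_mod_cast Real.sq_sqrt hx.le
  have hs0 : (√x : ℂ) ≠ 0 := Complex.ofReal_ne_zero.2 (Real.sqrt_ne_zero'.2 hx)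
  refine hd.deriv.trans ?_
  rw [← hs]
  field_simp
  linear_combination (-8 * a x * b x * (√x : ℂ)) * Complex.I_sq

theorem hasDerivAt_iteratedDeriv {f : ℝ → ℂ} {n k : ℕ} {x : ℝ} (h : ContDiffAt ℝ n f x)
    (hk : k < n) : HasDerivAt (iteratedDeriv k f) (iteratedDeriv (k + 1) f x) x := by
  have hd := h.contDiffWithinAt (s := univ) |>.differentiableWithinAt_iteratedDerivWithin (m := k)
    (by exact_mod_cast hk) (by simp [uniqueDiffOn_univ])
  rw [differentiableWithinAt_univ, iteratedDerivWithin_univ] at hd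
  rw [iteratedDeriv_succ]
  exact hd.hasDerivAt

/-- Expansion of the factored fourth-order operator. -/
theorem sqrt_mul_sqrtOp_eulerOp {f : ℝ → ℂ} (hf : ContDiffOn ℝ 4 f (Ioi 0)) (c : ℂ) {x : ℝ}
    (hx : 0 < x) :
    (√x : ℂ) * sqrtOp (fun t => eulerOp (eulerOp f) t + c * f t) x =
      (x : ℂ) ^ 3 * iteratedDeriv 4 f x + (11 / 2 : ℂ) * (x : ℂ) ^ 2 * iteratedDeriv 3 f x
        + (x : ℂ) * (11 / 2 + c) * iteratedDeriv 2 f x + (1 / 2 : ℂ) * (1 + c) * deriv f x := by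
  have hd : ∀ k < 4, ∀ t : ℝ, 0 < t →
      HasDerivAt (iteratedDeriv k f) (iteratedDeriv (k + 1) f t) t := fun k hk t ht =>
    hasDerivAt_iteratedDeriv (n := 4) (hf.contDiffAt (Ioi_mem_nhds ht)) hk
  have hid : ∀ t : ℝ, HasDerivAt (fun t : ℝ => (t : ℂ)) 1 t :=
    fun t => (hasDerivAt_id' t).ofReal_comp
  simp only [← iteratedDeriv_one]
  have h₂ : EqOn (fun t => eulerOp (eulerOp f) t + c * f t)
      (fun t : ℝ => (t : ℂ) ^ 2 * iteratedDeriv 2 f t + (t : ℂ) * iteratedDeriv 1 f t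
        + c * iteratedDeriv 0 f t) (Ioi 0) := by
    intro t ht
    have h : eulerOp f = fun t : ℝ => (t : ℂ) * iteratedDeriv 1 f t := by
      rw [iteratedDeriv_one]
      rfl
    have hd₁ : HasDerivAt (fun t : ℝ => (t : ℂ) * iteratedDeriv 1 f t) _ t :=
      (hid t).mul (hd 1 (by norm_num) t ht)
    dsimp only
    rw [h, eulerOp, HasDerivAt.deriv hd₁, iteratedDeriv_zero]
    ring
  have h₃ : EqOn
      (fun t => (√t : ℂ) * deriv (fun t : ℝ => (t : ℂ) ^ 2 * iteratedDeriv 2 f t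
        + (t : ℂ) * iteratedDeriv 1 f t + c * iteratedDeriv 0 f t) t)
      (fun t => (√t : ℂ) * ((t : ℂ) ^ 2 * iteratedDeriv 3 f t + 3 * (t * iteratedDeriv 2 f t)
        + (1 + c) * iteratedDeriv 1 f t)) (Ioi 0) := by
    intro t ht
    have hd₂ := ((((hid t).pow 2).mul (hd 2 (by norm_num) t ht)).add
      ((hid t).mul (hd 1 (by norm_num) t ht))).add ((hd 0 (by norm_num) t ht).const_mul c)
    dsimp only
    refine congrArg _ (hd₂.deriv.trans ?_)
    simp only [Pi.pow_apply]
    push_cast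
    ring
  rw [sqrtOp_congr h₂ hx, sqrtOp, (h₃.eventuallyEq_of_mem (Ioi_mem_nhds hx)).deriv_eq]
  have hd₃ := (Real.hasDerivAt_sqrt hx.ne').ofReal_comp.mul
    (((((hid x).pow 2).mul (hd 3 (by norm_num) x hx)).add
      (((hid x).mul (hd 2 (by norm_num) x hx)).const_mul 3)).add
      ((hd 1 (by norm_num) x hx).const_mul (1 + c)))
  have hs : (√x : ℂ) ^ 2 = x := by exact_mod_cast Real.sq_sqrt hx.le
  have hs0 : (√x : ℂ) ≠ 0 := Complex.ofReal_ne_zero.2 (Real.sqrt_ne_zero'.2 hx)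
  refine (congrArg _ hd₃.deriv).trans ?_
  simp only [Pi.pow_apply, Pi.add_apply, Pi.mul_apply]
  push_cast
  rw [← hs]
  field_simp
  ring

theorem sqrtOp_eulerOp_kernel (τ : ℝ) {x : ℝ} (hx : 0 < x) :
    sqrtOp (fun t : ℝ => eulerOp (eulerOp (fun u : ℝ => kernel u τ)) t
      + (τ : ℂ) ^ 2 * kernel t τ) x = kernel x τ / (√x : ℂ) := by
  obtain ⟨hp, hm⟩ := re_exp_pi_div_four_mul_I_pos
  obtain ⟨hp₂, hm₂⟩ := exp_pi_div_four_mul_I_sq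
  have harg : ∀ t : ℝ, 0 < t → (kelvinArg t : ℂ) ^ 2 = 8 * √t := fun t ht => by
    exact_mod_cast kelvinArg_sq ht
  simp only [kernel_eq]
  refine sqrtOp_eulerOp_mul_eq
    (fun t ht => hasDerivAt_besselK_comp _
      (u := fun t => (kelvinArg t : ℂ) * Complex.exp (Real.pi * Complex.I / 4))
      (re_kelvinArg_mul_pos hp ht)
      (hasDerivAt_kelvinArg_mul _ ht))
    (fun t ht => (hasDerivAt_besselMoment_one_comp _
      (u := fun t => (kelvinArg t : ℂ) * Complex.exp (Real.pi * Complex.I / 4))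
      (re_kelvinArg_mul_pos hp ht)
      (hasDerivAt_kelvinArg_mul _ ht)).congr_deriv ?_)
    (fun t ht => hasDerivAt_besselK_comp _
      (u := fun t => (kelvinArg t : ℂ) * Complex.exp (-(Real.pi * Complex.I / 4)))
      (re_kelvinArg_mul_pos hm ht)
      (hasDerivAt_kelvinArg_mul _ ht))
    (fun t ht => (hasDerivAt_besselMoment_one_comp _
      (u := fun t => (kelvinArg t : ℂ) * Complex.exp (-(Real.pi * Complex.I / 4)))
      (re_kelvinArg_mul_pos hm ht)
      (hasDerivAt_kelvinArg_mul _ ht)).congr_deriv ?_) hx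
  · rw [mul_pow, mul_pow, mul_pow, harg t ht, hp₂, Complex.I_sq]
    ring
  · rw [mul_pow, mul_pow, mul_pow, harg t ht, hm₂, Complex.I_sq]
    ring

end KelvinIndex

theorem lemma2 (τ : ℝ) :
    ContDiffOn ℝ 4 (fun x : ℝ => KelvinIndex.kernel x τ) (Set.Ioi 0) ∧
    (∀ x : ℝ, 0 < x →
      (x : ℂ) ^ 3 * iteratedDeriv 4 (fun t : ℝ => KelvinIndex.kernel t τ) x
        + (11 / 2 : ℂ) * (x : ℂ) ^ 2 * iteratedDeriv 3 (fun t : ℝ => KelvinIndex.kernel t τ) x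
        + (x : ℂ) * (11 / 2 + (τ : ℂ) ^ 2) *
            iteratedDeriv 2 (fun t : ℝ => KelvinIndex.kernel t τ) x
        + (1 / 2 : ℂ) * (1 + (τ : ℂ) ^ 2) * deriv (fun t : ℝ => KelvinIndex.kernel t τ) x
        - KelvinIndex.kernel x τ = 0) ∧
    (∀ x : ℝ, 0 < x →
      KelvinIndex.sqrtOp (fun t : ℝ =>
          KelvinIndex.eulerOp (KelvinIndex.eulerOp (fun u : ℝ => KelvinIndex.kernel u τ)) t
            + (τ : ℂ) ^ 2 * KelvinIndex.kernel t τ) x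
        = KelvinIndex.kernel x τ / (Real.sqrt x : ℂ)) := by
  refine ⟨KelvinIndex.contDiffOn_kernel τ 4, fun x hx => ?_,
    fun x hx => KelvinIndex.sqrtOp_eulerOp_kernel τ hx⟩
  have hs : (√x : ℂ) ≠ 0 := Complex.ofReal_ne_zero.2 (Real.sqrt_ne_zero'.2 hx)
  rw [← KelvinIndex.sqrt_mul_sqrtOp_eulerOp (KelvinIndex.contDiffOn_kernel τ 4) _ hx,
    KelvinIndex.sqrtOp_eulerOp_kernel τ hx, mul_div_cancel₀ _ hs, sub_self]
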